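/- A partition $\mu$ is a finite weakly decreasing sequence $\mu_1\ge\dots\ge\mu_{l(\mu)}$ of positive integers; $l(\mu)$ is its length, $|\mu|=\sum_i\mu_i$ its weight, $m_i(\mu)$ the number of parts equal to $i$, and $z_\mu=\prod_{i\ge1} i^{m_i(\mu)}\,m_i(\mu)!$. For an integer $k\ge 0$, let $\left\langle{\mu\atop k}\right\rangle$ be the number of ways to choose $k$ points in the Ferrers diagram of $\mu$ (whose $i$-th row has $\mu_i$ points) so that at least one point is chosen on each row; for the empty partition and $k=0$ this number is $1$. For an integer $m\ge0$ put $(i)_m=i(i+1)\cdots(i+m-1)$ and $\binom{z}{m}=\frac{z(z-1)\cdots(z-m+1)}{m!}$. For a family of independent indeterminates $X=\{X_1,X_2,X_3,\ldots\}$ and integers $j,k\ge0$ put $$P_{jk}(X)=\sum_{|\mu|=j}\frac{\left\langle{\mu\atop k}\right\rangle}{z_\mu}\prod_{i\ge1}X_i^{m_i(\mu)},$$ so that $P_{00}(X)=1$. **Theorem 2.** Let $z$, $u$ and $X=\{X_1,X_2,X_3,\ldots\}$ be independent indeterminates over a commutative $\mathbb{Q}$-algebra $K$. For every integer $n\ge1$,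 the following identity of formal power series in $u$, with coefficients in the polynomial ring $K[z,X_1,X_2,\ldots]$, holds: $$\sum_{|\mu|=n}\frac{(-1)^{n-l(\mu)}}{z_\mu}\prod_{i\ge1}\left(z+\sum_{k\ge1}u^k\frac{(i)_k}{k!}X_k\right)^{m_i(\mu)}=\sum_{j\ge0}u^j\left(\sum_{k=0}^{\min(n,j)}\binom{z-j}{n-k}P_{jk}(X)\right).$$ -/

import Mathlib

namespace PartitionIdentity

/-- The length `l(μ)` of a partition. -/
def length {n : ℕ} (μ : n.Partition) : ℕ := μ.parts.card

/-- The multiplicity `m_i(μ)` of `i` in a partition. -/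
def mult {n : ℕ} (μ : n.Partition) (i : ℕ) : ℕ := μ.parts.count i

/-- `z_μ = ∏_{i ≥ 1} i ^ m_i(μ) * m_i(μ)!`; the factors with `m_i(μ) = 0` are `1` and are
left out. -/
def zee {n : ℕ} (μ : n.Partition) : ℕ :=
  ∏ i ∈ μ.parts.toFinset, i ^ mult μ i * (mult μ i).factorial

/-- The Ferrers diagram of a partition: row `i` has `μ_i` cells (rows and columns are numbered
from `0`). -/
def diagram {n : ℕ} (μ : n.Partition) : YoungDiagram :=
  YoungDiagram.ofRowLens (μ.parts.sort (· ≥ ·))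
    (Multiset.pairwise_sort μ.parts (· ≥ ·)).sortedGE

/-- The generalized binomial coefficient `⟨μ, r⟩`: the number of ways to choose `r` points of the
diagram of `μ` with at least one point chosen on each of its `l(μ)` rows. -/
def rowBinom {n : ℕ} (μ : n.Partition) (r : ℕ) : ℕ :=
  (((diagram μ).cells.powersetCard r).filter
    fun S => ∀ i ∈ Finset.range (length μ), ∃ c ∈ S, c.1 = i).card

/-- `P_{jk}(X) = ∑_{|μ| = j} ⟨μ, k⟩ / z_μ * ∏_{i ≥ 1} X_i ^ m_i(μ)`, for a family `X` of elements
of a commutative `ℚ`-algebra. The value `X 0` is not used, since partitions have positive parts. -/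
noncomputable def P {R : Type*} [CommRing R] [Algebra ℚ R] (X : ℕ → R) (j k : ℕ) : R :=
  ∑ μ : j.Partition,
    ((rowBinom μ k : ℚ) / (zee μ : ℚ)) • ∏ i ∈ μ.parts.toFinset, X i ^ mult μ i

/-- `binom(z, m) = z (z - 1) ⋯ (z - m + 1) / m!`. -/
noncomputable def binom {R : Type*} [CommRing R] [Algebra ℚ R] (z : R) (m : ℕ) : R :=
  (1 / (m.factorial : ℚ)) • (descPochhammer R m).eval z

/-- The formal power series `z + ∑_{k ≥ 1} u ^ k * (i)_k / k! * X_k` in the variable `u`, where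
`(i)_k = i (i + 1) ⋯ (i + k - 1)`. -/
noncomputable def rowSeries {R : Type*} [CommRing R] [Algebra ℚ R] (z : R) (X : ℕ → R) (i : ℕ) :
    PowerSeries R :=
  PowerSeries.C z +
    PowerSeries.mk fun k => if k = 0 then 0 else
      ((i.ascFactorial k : ℚ) / (k.factorial : ℚ)) • X k

/-- The left-hand side: the sum over the partitions `μ` of `n` of
`(-1) ^ (n - l(μ)) / z_μ * ∏_{i ≥ 1} (z + ∑_{k ≥ 1} u ^ k * (i)_k / k! * X_k) ^ m_i(μ)`
(note `l(μ) ≤ n`), a formal power series in `u`. -/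
noncomputable def partitionSum {R : Type*} [CommRing R] [Algebra ℚ R] (z : R) (X : ℕ → R)
    (n : ℕ) : PowerSeries R :=
  ∑ μ : n.Partition, ((-1 : ℚ) ^ (n - length μ) / (zee μ : ℚ)) •
    ∏ i ∈ μ.parts.toFinset, rowSeries z X i ^ mult μ i

/-- Names for the independent indeterminates `z`, `X_1, X_2, …`; the power series variable `u` is
separate, and `X 0` is a dummy that occurs nowhere. -/
inductive Indet where
  | z : Indet
  | X (k : ℕ) : Indet

end PartitionIdentity

namespace PartitionIdentity

/-! ### Removing a part from a partition -/

/-! Multiply by `t ^ n` and sum over `n ≥ 0`. The left side becomes, formally, `exp(∑ (-1)^(i-1)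
t^i/i · rowSeries i)`. On the right, choosing points row by row gives `∑_k ⟨μ, k⟩ t^k = ∏ ((1+t)^μ_i
- 1)` (`mk_rowBinom`), so that side is `(1+t)^z exp(∑ u^i X_i (1 - (1+t)^(-i))/i)`. Expanding
`(1+t)^(-i)` in `t` identifies the two.

No exponential is formed. A cycle index is determined by the recursion `n a_n = ∑ x_i a_(n-i)`
(`natCast_mul_cycleIndex`, `eq_cycleIndex_of_rec`), that is, by its logarithmic Euler derivative.
The right side is built from cycle indices in `u`, so its derivative in `u` is known; since the two
Euler operators commute, `innerEuler_eq_mul` turns this into its derivative in `t`. By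
`coeff_logDerivT` the resulting recursion in `n` is that of the left side. -/

/-- `z_s` for a multiset `s`. -/
def multisetZee (s : Multiset ℕ) : ℕ :=
  ∏ i ∈ s.toFinset, i ^ s.count i * (s.count i).factorial

theorem zee_eq {n : ℕ} (μ : n.Partition) : zee μ = multisetZee μ.parts := rfl

theorem multisetZee_cons (i : ℕ) (s : Multiset ℕ) :
    multisetZee (i ::ₘ s) = i * (s.count i + 1) * multisetZee s := by
  have key : ∀ t : Multiset ℕ, t.toFinset ⊆ insert i s.toFinset →
      multisetZee t = i ^ t.count i * (t.count i).factorial *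
        ∏ j ∈ s.toFinset.erase i, j ^ t.count j * (t.count j).factorial := by
    intro t ht
    rw [multisetZee, Finset.prod_subset ht, ← Finset.mul_prod_erase _ _ (Finset.mem_insert_self _ _),
      Finset.erase_insert_eq_erase]
    intro j _ hj
    rw [Multiset.mem_toFinset] at hj
    simp [Multiset.count_eq_zero_of_notMem hj]
  rw [key _ (by simp), key s (Finset.subset_insert _ _), Multiset.count_cons_self,
    Nat.factorial_succ, pow_succ]
  have : ∏ j ∈ s.toFinset.erase i, j ^ (i ::ₘ s).count j * ((i ::ₘ s).count j).factorial =
      ∏ j ∈ s.toFinset.erase i, j ^ s.count j * (s.count j).factorial := by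
    refine Finset.prod_congr rfl fun j hj => ?_
    rw [Multiset.count_cons_of_ne (Finset.ne_of_mem_erase hj)]
  rw [this]
  ring

theorem multisetZee_ne_zero {s : Multiset ℕ} (hs : ∀ i ∈ s, 0 < i) : multisetZee s ≠ 0 := by
  refine Finset.prod_ne_zero_iff.2 fun i hi => ?_
  have := hs i (Multiset.mem_toFinset.1 hi)
  positivity

theorem isUnit_natCast {S : Type*} [CommRing S] [Algebra ℚ S] {n : ℕ} (hn : 0 < n) :
    IsUnit (n : S) := by
  have : IsUnit (algebraMap ℚ S n) := (IsUnit.mk0 (n : ℚ) (by positivity)).map _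
  simpa using this

theorem prod_mult {R : Type*} [CommRing R] {n : ℕ} (μ : n.Partition) (x : ℕ → R) :
    ∏ i ∈ μ.parts.toFinset, x i ^ mult μ i = (μ.parts.map x).prod :=
  (Finset.prod_multiset_map_count _ _).symm

theorem neg_one_pow_sub_length {R : Type*} [CommRing R] {n : ℕ} (μ : n.Partition) :
    (-1 : R) ^ (n - length μ) = (μ.parts.map fun i => (-1 : R) ^ (i - 1)).prod := by
  -- The bound is carried through the induction because the subtraction is truncated.
  have : ∀ s : Multiset ℕ, (∀ i ∈ s, 0 < i) → s.card ≤ s.sum ∧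
      (-1 : R) ^ (s.sum - s.card) = (s.map fun i => (-1 : R) ^ (i - 1)).prod := by
    intro s
    induction s using Multiset.induction with
    | empty => simp
    | cons a s ih =>
      intro h
      have ha := h a (Multiset.mem_cons_self _ _)
      obtain ⟨h1, h2⟩ := ih fun i hi => h i (Multiset.mem_cons_of_mem hi)
      rw [Multiset.sum_cons, Multiset.card_cons, Multiset.map_cons, Multiset.prod_cons, ← h2,
        ← pow_add]
      exact ⟨by omega, by congr 1; omega⟩
  have := (this μ.parts fun i hi => μ.parts_pos hi).2
  rwa [μ.parts_sum] at this

/-! ### The cycle index and its recursion -/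

section Algebra

variable {R : Type*} [CommRing R] [Algebra ℚ R]

/-- The summand `∏_{i ∈ s} x_i / z_s` of the cycle index. -/
noncomputable def weight (x : ℕ → R) (s : Multiset ℕ) : R :=
  (1 / (multisetZee s : ℚ)) • (s.map x).prod

/-- The cycle index `∑_{|μ| = n} x_μ / z_μ`. -/
noncomputable def cycleIndex (x : ℕ → R) (n : ℕ) : R :=
  ∑ μ : n.Partition, weight x μ.parts

theorem weight_cons (x : ℕ → R) {i : ℕ} {s : Multiset ℕ} (hi : 0 < i) (hs : ∀ j ∈ s, 0 < j) :
    (i * (s.count i + 1) : ℚ) • weight x (i ::ₘ s) = x i * weight x s := by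
  have h := multisetZee_ne_zero hs
  rw [weight, weight, multisetZee_cons, smul_smul, mul_smul_comm, Multiset.map_cons,
    Multiset.prod_cons]
  congr 1
  have : (i : ℚ) ≠ 0 := by positivity
  have : (s.count i + 1 : ℚ) ≠ 0 := by positivity
  have : (multisetZee s : ℚ) ≠ 0 := by exact_mod_cast h
  push_cast
  field_simp

theorem weight_erase (x : ℕ → R) {i : ℕ} {s : Multiset ℕ} (hs : ∀ j ∈ s, 0 < j) (hi : i ∈ s) :
    (s.count i * i : ℚ) • weight x s = x i * weight x (s.erase i) := by
  obtain ⟨t, rfl⟩ := Multiset.exists_cons_of_mem hi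
  rw [Multiset.erase_cons_head, ← weight_cons x (hs i hi)
    (fun j hj => hs j (Multiset.mem_cons_of_mem hj)), Multiset.count_cons_self]
  push_cast
  rw [mul_comm]

theorem sum_weight_erase (x : ℕ → R) {n i : ℕ} (hi : 0 < i) (hin : i ≤ n) :
    ∑ μ : n.Partition with i ∈ μ.parts, weight x (μ.parts.erase i) = cycleIndex x (n - i) := by
  have hsum : ∀ μ : n.Partition, i ∈ μ.parts → (μ.parts.erase i).sum = n - i := by
    intro μ hμ
    have := Multiset.sum_erase hμ
    rw [μ.parts_sum] at this
    omega
  refine Finset.sum_bij' (fun μ hμ => ⟨μ.parts.erase i,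
      fun hj => μ.parts_pos (Multiset.mem_of_mem_erase hj), hsum μ (by simpa using hμ)⟩)
    (fun ν _ => ⟨i ::ₘ ν.parts, ?_, ?_⟩) ?_ ?_ ?_ ?_ ?_
  · intro j hj
    rcases Multiset.mem_cons.1 hj with rfl | hj
    exacts [hi, ν.parts_pos hj]
  · rw [Multiset.sum_cons, ν.parts_sum]
    omega
  · simp
  · simp
  · intro μ hμ
    ext1
    exact Multiset.cons_erase (by simpa using hμ)
  · intro ν _
    ext1
    exact Multiset.erase_cons_head _ _
  · simp

/-- Write `n = ∑ i · m_i(μ)` over the distinct parts of `μ`. The factor `i · m_i(μ)` is what `z_μ`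
loses when one part `i` is removed, and removal is a bijection onto the partitions of `n - i`. -/
theorem natCast_mul_cycleIndex (x : ℕ → R) (n : ℕ) :
    (n : R) * cycleIndex x n = ∑ i ∈ Finset.Icc 1 n, x i * cycleIndex x (n - i) := by
  have h1 : ∀ μ : n.Partition, (n : R) * weight x μ.parts =
      ∑ i ∈ Finset.Icc 1 n, if i ∈ μ.parts then x i * weight x (μ.parts.erase i) else 0 := by
    intro μ
    have hn : (n : ℚ) = ∑ i ∈ μ.parts.toFinset, (μ.parts.count i * i : ℚ) := by
      conv_lhs => rw [← μ.parts_sum, Finset.sum_multiset_count]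
      push_cast
      simp
    have hn' : (n : R) * weight x μ.parts = (n : ℚ) • weight x μ.parts := by
      rw [Algebra.smul_def, map_natCast]
    rw [hn', hn, Finset.sum_smul, ← Finset.sum_filter]
    refine Finset.sum_congr ?_ fun i hi => weight_erase x (fun j hj => μ.parts_pos hj) ?_
    · ext i
      simp only [Multiset.mem_toFinset, Finset.mem_filter, Finset.mem_Icc]
      exact ⟨fun h => ⟨⟨μ.parts_pos h, μ.le_of_mem_parts h⟩, h⟩, fun h => h.2⟩
    · simpa using (Finset.mem_filter.1 hi).2
  rw [cycleIndex, Finset.mul_sum, Finset.sum_congr rfl fun μ _ => h1 μ, Finset.sum_comm]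
  refine Finset.sum_congr rfl fun i hi => ?_
  rw [← Finset.sum_filter, ← Finset.mul_sum,
    sum_weight_erase x (Finset.mem_Icc.1 hi).1 (Finset.mem_Icc.1 hi).2]

theorem cycleIndex_zero (x : ℕ → R) : cycleIndex x 0 = 1 := by
  simp [cycleIndex, weight, multisetZee]

/-- A sequence with `a_0 = 1` that satisfies the recursion of the cycle index equals it. -/
theorem eq_cycleIndex_of_rec (x a : ℕ → R) (h0 : a 0 = 1)
    (h : ∀ n : ℕ, (n : R) * a n = ∑ i ∈ Finset.Icc 1 n, x i * a (n - i)) (n : ℕ) :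
    a n = cycleIndex x n := by
  induction n using Nat.strong_induction_on with
  | _ n ih =>
    rcases Nat.eq_zero_or_pos n with rfl | hn
    · rw [h0, cycleIndex_zero]
    · refine (isUnit_natCast (S := R) hn).mul_left_cancel ?_
      rw [h, natCast_mul_cycleIndex]
      refine Finset.sum_congr rfl fun i hi => ?_
      have := Finset.mem_Icc.1 hi
      rw [ih _ (by omega)]

theorem partitionSum_eq_cycleIndex (z : R) (X : ℕ → R) (n : ℕ) :
    partitionSum z X n = cycleIndex (fun i => (-1) ^ (i - 1) * rowSeries z X i) n := by
  refine Finset.sum_congr rfl fun μ _ => ?_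
  rw [weight, Multiset.prod_map_mul, ← neg_one_pow_sub_length, prod_mult, zee_eq, div_eq_mul_one_div,
    mul_comm, mul_smul]
  congr 1
  rw [Algebra.smul_def, map_pow, map_neg, map_one]

end Algebra


/-! ### The generating function of the generalized binomial coefficients -/

theorem card_cellsOfRowLens (l : List ℕ) : (YoungDiagram.cellsOfRowLens l).card = l.sum := by
  induction l with
  | nil => rfl
  | cons w l ih =>
    rw [YoungDiagram.cellsOfRowLens, Finset.card_union_of_disjoint, Finset.card_map, ih]
    · simp
    · rw [Finset.disjoint_left]
      rintro ⟨a, b⟩ h1 h2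
      simp at h1 h2
      omega

theorem rowBinom_eq_zero {n k : ℕ} (μ : n.Partition) (h : n < k) : rowBinom μ k = 0 := by
  have : (diagram μ).cells.card = n := by
    refine (card_cellsOfRowLens _).trans ?_
    rw [← Multiset.sum_coe, Multiset.sort_eq, μ.parts_sum]
  rw [rowBinom, Finset.powersetCard_eq_empty.2 (this.trans_lt h), Finset.filter_empty,
    Finset.card_empty]

section Rows

variable {R : Type*} [CommRing R]

theorem sum_nonempty_powerset_pow (t : R) (s : Finset ℕ) :
    ∑ T ∈ s.powerset with T.Nonempty, t ^ T.card = (1 + t) ^ s.card - 1 := by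
  have h := Finset.sum_pow_mul_eq_add_pow t 1 s
  simp only [one_pow, mul_one] at h
  rw [add_comm 1 t, ← h, ← Finset.sum_filter_add_sum_filter_not s.powerset Finset.Nonempty]
  have : s.powerset.filter (fun T => ¬ T.Nonempty) = {∅} := by
    ext T
    simp only [Finset.mem_filter, Finset.mem_powerset, Finset.not_nonempty_iff_eq_empty,
      Finset.mem_singleton]
    exact ⟨fun h => h.2, fun h => ⟨h ▸ Finset.empty_subset _, h⟩⟩
  rw [this]
  simp

/-- An admissible set of cells is an independent choice of a nonempty subset of each row. -/
theorem sum_pow_card_rows (t : R) (l : List ℕ) :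
    ∑ S ∈ (YoungDiagram.cellsOfRowLens l).powerset with
      ∀ i ∈ Finset.range l.length, ∃ c ∈ S, c.1 = i, t ^ S.card =
        (l.map fun i => (1 + t) ^ i - 1).prod := by
  have h1 : (l.map fun i => (1 + t) ^ i - 1).prod =
      ∏ i : Fin l.length, ∑ T ∈ (Finset.range l[i]).powerset with T.Nonempty, t ^ T.card := by
    simp only [sum_nonempty_powerset_pow, Finset.card_range]
    exact (Fin.prod_univ_fun_getElem l fun i => (1 + t) ^ i - 1).symm
  have hfib : ∀ (S : Finset (ℕ × ℕ)) (i j : ℕ),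
      j ∈ (S.filter (fun c => c.1 = i)).image Prod.snd ↔ (i, j) ∈ S := by
    intro S i j
    simp
  rw [h1, Finset.prod_univ_sum]
  refine Finset.sum_bij'
    (fun (S : Finset (ℕ × ℕ)) _ (i : Fin l.length) => (S.filter (fun c => c.1 = (i : ℕ))).image Prod.snd)
    (fun x _ => (YoungDiagram.cellsOfRowLens l).filter
      fun c => ∃ h : c.1 < l.length, c.2 ∈ x ⟨c.1, h⟩) ?_ ?_ ?_ ?_ ?_
  · intro S hS
    rw [Finset.mem_filter, Finset.mem_powerset] at hS
    rw [Fintype.mem_piFinset]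
    intro i
    rw [Finset.mem_filter, Finset.mem_powerset]
    refine ⟨fun j hj => ?_, ?_⟩
    · obtain ⟨_, h⟩ := YoungDiagram.mem_cellsOfRowLens.1 (hS.1 ((hfib _ _ _).1 hj))
      exact Finset.mem_range.2 h
    · obtain ⟨⟨a, b⟩, hc, rfl⟩ := hS.2 i (Finset.mem_range.2 i.2)
      exact ⟨b, (hfib _ _ _).2 hc⟩
  · intro x hx
    rw [Fintype.mem_piFinset] at hx
    rw [Finset.mem_filter, Finset.mem_powerset]
    refine ⟨Finset.filter_subset _ _, fun i hi => ?_⟩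
    rw [Finset.mem_range] at hi
    have hxi := hx ⟨i, hi⟩
    rw [Finset.mem_filter, Finset.mem_powerset] at hxi
    obtain ⟨j, hj⟩ := hxi.2
    refine ⟨(i, j), ?_, rfl⟩
    rw [Finset.mem_filter, YoungDiagram.mem_cellsOfRowLens]
    exact ⟨⟨hi, Finset.mem_range.1 (hxi.1 hj)⟩, hi, hj⟩
  · intro S hS
    rw [Finset.mem_filter, Finset.mem_powerset] at hS
    ext ⟨a, b⟩
    rw [Finset.mem_filter]
    constructor
    · rintro ⟨_, _, h⟩
      exact (hfib _ _ _).1 h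
    · intro h
      obtain ⟨h', _⟩ := YoungDiagram.mem_cellsOfRowLens.1 (hS.1 h)
      exact ⟨hS.1 h, h', (hfib _ _ _).2 h⟩
  · intro x hx
    rw [Fintype.mem_piFinset] at hx
    funext i
    ext j
    rw [hfib, Finset.mem_filter, YoungDiagram.mem_cellsOfRowLens]
    have hxi := hx i
    rw [Finset.mem_filter, Finset.mem_powerset] at hxi
    exact ⟨fun h => h.2.2, fun h => ⟨⟨i.2, Finset.mem_range.1 (hxi.1 h)⟩, i.2, h⟩⟩
  · intro S hS
    rw [Finset.mem_filter, Finset.mem_powerset] at hS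
    rw [Finset.prod_pow_eq_pow_sum]
    congr 1
    -- The cells are counted row by row; the column index is injective on a row.
    rw [Finset.card_eq_sum_card_fiberwise (f := Prod.fst) (t := Finset.range l.length),
      Finset.sum_range]
    · refine Finset.sum_congr rfl fun i _ => (Finset.card_image_of_injOn ?_).symm
      rintro ⟨a, b⟩ h ⟨a', b'⟩ h' heq
      simp only [Finset.coe_filter, Set.mem_ofPred_eq] at h h' heq
      rw [h.2, h'.2, heq]
    · intro c hc
      obtain ⟨h', _⟩ := YoungDiagram.mem_cellsOfRowLens.1 (hS.1 hc)
      simpa using h'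

theorem mk_rowBinom {n : ℕ} (μ : n.Partition) :
    PowerSeries.mk (fun k => (rowBinom μ k : R)) =
      (μ.parts.map fun i => (1 + PowerSeries.X : PowerSeries R) ^ i - 1).prod := by
  have h := sum_pow_card_rows (PowerSeries.X : PowerSeries R) (μ.parts.sort (· ≥ ·))
  rw [← Multiset.prod_coe, ← Multiset.map_coe, Multiset.sort_eq, Multiset.length_sort] at h
  rw [← h]
  ext k
  rw [PowerSeries.coeff_mk, map_sum, rowBinom]
  simp only [PowerSeries.coeff_X_pow]
  rw [Finset.sum_boole, Finset.filter_filter]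
  congr 2
  ext S
  simp only [Finset.mem_filter, Finset.mem_powersetCard, Finset.mem_powerset]
  exact ⟨fun h => ⟨h.1.1, h.2, h.1.2.symm⟩, fun h => ⟨⟨h.1, h.2.2.symm⟩, h.2.1⟩⟩

end Rows

theorem mk_P {R : Type*} [CommRing R] [Algebra ℚ R] (X : ℕ → R) (j : ℕ) :
    PowerSeries.mk (P X j) =
      cycleIndex (fun i => PowerSeries.C (X i) * ((1 + PowerSeries.X) ^ i - 1)) j := by
  ext k
  rw [PowerSeries.coeff_mk, cycleIndex, P, map_sum]
  refine Finset.sum_congr rfl fun μ _ => ?_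
  have hC : (μ.parts.map fun i => PowerSeries.C (X i)).prod =
      PowerSeries.C ((μ.parts.map X).prod) := by
    rw [map_multiset_prod, Multiset.map_map]
    rfl
  rw [weight, Multiset.prod_map_mul, ← mk_rowBinom, hC, prod_mult, zee_eq, PowerSeries.coeff_smul,
    PowerSeries.coeff_C_mul, PowerSeries.coeff_mk, div_eq_mul_one_div, mul_comm, mul_smul]
  congr 1
  rw [Algebra.smul_def, map_natCast, mul_comm]

theorem P_eq_zero {R : Type*} [CommRing R] [Algebra ℚ R] (X : ℕ → R) {j k : ℕ} (h : j < k) :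
    P X j k = 0 := by
  simp [P, rowBinom_eq_zero _ h]


/-! ### Binomial series -/

section Binomial

variable {R : Type*} [CommRing R] [Algebra ℚ R]

/-- Coefficient form of `(1 + t) f' = z f` for `f = (1 + t)^z`. -/
theorem binom_succ (z : R) (m : ℕ) :
    ((m : R) + 1) * binom z (m + 1) = (z - m) * binom z m := by
  have h : ((m : R) + 1) = algebraMap ℚ R ((m : ℚ) + 1) := by simp
  have hm : (m : ℚ) + 1 ≠ 0 := by positivity
  have hf : (m.factorial : ℚ) ≠ 0 := by positivity
  rw [h, ← Algebra.smul_def, binom, binom, smul_smul, descPochhammer_succ_eval, mul_smul_comm,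
    mul_comm (z - m)]
  congr 1
  rw [Nat.factorial_succ]
  push_cast
  field_simp

theorem binom_pascal (z : R) (m : ℕ) :
    binom z (m + 1) = binom (z - 1) (m + 1) + binom (z - 1) m := by
  have h := congrArg (Polynomial.eval z) (descPochhammer_succ_comp_X_sub_one (R := R) m)
  simp only [Polynomial.eval_comp, Polynomial.eval_sub, Polynomial.eval_X, Polynomial.eval_one,
    Polynomial.eval_add, Polynomial.eval_natCast, smul_eq_mul,
    Polynomial.eval_mul] at h
  have hm : (m : ℚ) + 1 ≠ 0 := by positivity
  have hf : (m.factorial : ℚ) ≠ 0 := by positivity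
  have e : binom (z - 1) m = (1 / ((m + 1).factorial : ℚ)) •
      (((m : R) + 1) * (descPochhammer R m).eval (z - 1)) := by
    have h : ((m : R) + 1) = algebraMap ℚ R ((m : ℚ) + 1) := by simp
    rw [h, ← Algebra.smul_def, smul_smul, binom]
    congr 1
    rw [Nat.factorial_succ]
    push_cast
    field_simp
  rw [e, binom, binom, ← smul_add, h]
  congr 1
  ring

theorem binom_zero (z : R) : binom z 0 = 1 := by
  simp [binom]

/-- The binomial series `(1 + t) ^ z`. -/
noncomputable def binomSeries (z : R) : PowerSeries R := PowerSeries.mk (binom z)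

theorem binomSeries_eq_mul (z : R) :
    binomSeries z = (1 + PowerSeries.X) * binomSeries (z - 1) := by
  ext (_ | m)
  · simp [binomSeries, binom_zero]
  · rw [add_mul, one_mul, map_add, PowerSeries.coeff_succ_X_mul]
    simpa only [binomSeries, PowerSeries.coeff_mk] using binom_pascal z m

end Binomial

/-! ### Powers of `(1 + t)⁻¹` and the Euler operator -/

section Inverse

variable (R : Type*) [CommRing R]

/-- The series `(1 + t)⁻¹`. -/
noncomputable def geom : PowerSeries R := PowerSeries.mk fun n => (-1) ^ n

theorem geom_mul : geom R * (1 + PowerSeries.X) = 1 := by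
  ext (_ | m)
  · simp [geom]
  · rw [mul_add, mul_one, map_add, PowerSeries.coeff_succ_mul_X, PowerSeries.coeff_one,
      if_neg m.succ_ne_zero]
    simp [geom, pow_succ]

theorem coeff_geom_pow_succ (k i : ℕ) :
    PowerSeries.coeff i (geom R ^ (k + 1)) = (-1) ^ i * ((k + i).choose k : R) := by
  have : geom R = PowerSeries.rescale (-1 : R) (PowerSeries.mk 1) := by
    ext i
    simp [geom, PowerSeries.coeff_rescale]
  rw [this, ← map_pow, PowerSeries.mk_one_pow_eq_mk_choose_add, PowerSeries.coeff_rescale,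
    PowerSeries.coeff_mk]

theorem derivative_geom : PowerSeries.derivative R (geom R) = -geom R ^ 2 := by
  have h := congrArg (PowerSeries.derivative R) (geom_mul R)
  rw [Derivation.leibniz, map_add, PowerSeries.derivative_X, Derivation.map_one_eq_zero,
    smul_eq_mul, smul_eq_mul] at h
  linear_combination geom R * h - PowerSeries.derivative R (geom R) * geom_mul R

/-- The Euler operator `t d/dt`. -/
noncomputable def euler (f : PowerSeries R) : PowerSeries R :=
  PowerSeries.X * PowerSeries.derivative R f

variable {R}

theorem coeff_euler (f : PowerSeries R) (n : ℕ) :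
    PowerSeries.coeff n (euler R f) = n * PowerSeries.coeff n f := by
  rcases n with _ | n
  · simp [euler]
  · rw [euler, PowerSeries.coeff_succ_X_mul, PowerSeries.coeff_derivative]
    push_cast
    ring

theorem euler_mul (f g : PowerSeries R) : euler R (f * g) = euler R f * g + f * euler R g := by
  rw [euler, euler, euler, Derivation.leibniz, smul_eq_mul, smul_eq_mul]
  ring

theorem euler_sub (f g : PowerSeries R) : euler R (f - g) = euler R f - euler R g := by
  rw [euler, euler, euler, map_sub, mul_sub]

theorem euler_C_mul (a : R) (f : PowerSeries R) :
    euler R (PowerSeries.C a * f) = PowerSeries.C a * euler R f := by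
  ext n
  rw [coeff_euler, PowerSeries.coeff_C_mul, PowerSeries.coeff_C_mul, coeff_euler, mul_left_comm]

theorem euler_geom_pow (k : ℕ) :
    euler R (geom R ^ k) = -((k : PowerSeries R) * (PowerSeries.X * geom R ^ (k + 1))) := by
  rcases k with _ | k
  · simp [euler]
  · rw [euler, PowerSeries.derivative_pow, derivative_geom, Nat.add_sub_cancel]
    push_cast
    ring

end Inverse

theorem euler_binomSeries {R : Type*} [CommRing R] [Algebra ℚ R] (z : R) :
    euler R (binomSeries z) =
      PowerSeries.C z * (PowerSeries.X * geom R) * binomSeries z := by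
  have h : (1 + PowerSeries.X) * PowerSeries.derivative R (binomSeries z) =
      PowerSeries.C z * binomSeries z := by
    ext n
    rw [add_mul, one_mul, map_add, PowerSeries.coeff_C_mul]
    change _ + PowerSeries.coeff n (euler R (binomSeries z)) = _
    rw [coeff_euler, PowerSeries.coeff_derivative, binomSeries, PowerSeries.coeff_mk,
      PowerSeries.coeff_mk]
    linear_combination binom_succ z n
  rw [euler]
  linear_combination PowerSeries.X * geom R * h -
    PowerSeries.X * PowerSeries.derivative R (binomSeries z) * geom_mul R

/-! ### Double series -/

section Double

variable {R : Type*} [CommRing R]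

/-- The Euler operator in `t` on series in `u` with coefficients in `R⟦t⟧`. -/
noncomputable def innerEuler (F : PowerSeries (PowerSeries R)) : PowerSeries (PowerSeries R) :=
  PowerSeries.mk fun j => euler R (PowerSeries.coeff j F)

theorem innerEuler_mul (F G : PowerSeries (PowerSeries R)) :
    innerEuler (F * G) = innerEuler F * G + F * innerEuler G := by
  ext1 j
  rw [map_add, innerEuler, PowerSeries.coeff_mk, PowerSeries.coeff_mul, PowerSeries.coeff_mul,
    PowerSeries.coeff_mul, ← Finset.sum_add_distrib, euler, map_sum, Finset.mul_sum]
  refine Finset.sum_congr rfl fun p _ => ?_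
  simp only [innerEuler, PowerSeries.coeff_mk]
  exact euler_mul _ _

theorem euler_innerEuler (F : PowerSeries (PowerSeries R)) :
    euler _ (innerEuler F) = innerEuler (euler _ F) := by
  ext1 j
  rw [coeff_euler, innerEuler, innerEuler, PowerSeries.coeff_mk, PowerSeries.coeff_mk, coeff_euler]
  ext n
  rw [coeff_euler, ← map_natCast PowerSeries.C, PowerSeries.coeff_C_mul, PowerSeries.coeff_C_mul,
    coeff_euler]
  ring

/-- Since `Y` has no constant term, the equation expresses `n` times the `n`-th coefficient of `F`
through earlier ones, and `n > 0` is invertible. -/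
theorem eq_zero_of_euler_eq_mul {S : Type*} [CommRing S] [Algebra ℚ S] {Y F : PowerSeries S}
    (hY : PowerSeries.coeff 0 Y = 0) (hF : PowerSeries.coeff 0 F = 0)
    (h : euler S F = Y * F) : F = 0 := by
  ext n
  rw [map_zero]
  induction n using Nat.strong_induction_on with
  | _ n ih =>
    rcases Nat.eq_zero_or_pos n with rfl | hn
    · exact hF
    · refine (isUnit_natCast (S := S) hn).mul_left_cancel ?_
      rw [← coeff_euler, h, PowerSeries.coeff_mul, mul_zero]
      refine Finset.sum_eq_zero fun p hp => ?_
      rw [Finset.HasAntidiagonal.mem_antidiagonal] at hp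
      rcases Nat.eq_zero_or_pos p.1 with h0 | h0
      · rw [h0, hY, zero_mul]
      · rw [ih _ (by omega), mul_zero]

/-- If `u ∂B/∂u = Y B` and `t ∂Y/∂t = u ∂Q/∂u`, then `t ∂B/∂t = Q B` holds as soon as it holds
at `u = 0`. -/
theorem innerEuler_eq_mul [Algebra ℚ R] {B Y Q : PowerSeries (PowerSeries R)}
    (hB : euler _ B = Y * B) (hY : PowerSeries.coeff 0 Y = 0) (hYQ : innerEuler Y = euler _ Q)
    (h0 : PowerSeries.coeff 0 (innerEuler B) = PowerSeries.coeff 0 (Q * B)) :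
    innerEuler B = Q * B := by
  rw [← sub_eq_zero]
  refine eq_zero_of_euler_eq_mul hY (by rw [map_sub, h0, sub_self]) ?_
  -- Commuting the two operators shows that the defect `t ∂B/∂t - Q B` satisfies the same equation
  -- as `B`.
  rw [euler_sub, euler_innerEuler, hB, innerEuler_mul, euler_mul, hB, hYQ]
  ring

end Double


/-! ### Comparison of the two sides -/

section Main

variable {R : Type*} [CommRing R] [Algebra ℚ R]

theorem coeff_mul_of_coeff_zero {S : Type*} [CommRing S] {F : PowerSeries S}
    (hF : PowerSeries.coeff 0 F = 0) (G : PowerSeries S) (n : ℕ) :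
    PowerSeries.coeff n (F * G) =
      ∑ i ∈ Finset.Icc 1 n, PowerSeries.coeff i F * PowerSeries.coeff (n - i) G := by
  rw [PowerSeries.coeff_mul, Finset.Nat.sum_antidiagonal_eq_sum_range_succ_mk]
  symm
  refine Finset.sum_subset (fun i hi => ?_) fun i hi hi' => ?_
  · rw [Finset.mem_Icc] at hi
    exact Finset.mem_range.2 (by omega)
  · rw [Finset.mem_range] at hi
    rw [Finset.mem_Icc] at hi'
    obtain rfl : i = 0 := by omega
    rw [hF, zero_mul]

theorem binomSeries_sub_natCast (z : R) (j : ℕ) :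
    binomSeries (z - j) = binomSeries z * geom R ^ j := by
  induction j with
  | zero => simp
  | succ j ih =>
    have h := binomSeries_eq_mul (z - j)
    rw [sub_sub, ← Nat.cast_succ] at h
    rw [pow_succ, ← mul_assoc, ← ih, h]
    linear_combination (-binomSeries (z - (j.succ : ℕ))) * geom_mul R

/-- The coefficient of `u ^ j` on the right-hand side, as a series in `t`. -/
noncomputable def uCoeff (z : R) (X : ℕ → R) (j : ℕ) : PowerSeries R :=
  binomSeries z * geom R ^ j *
    cycleIndex (fun i => PowerSeries.C (X i) * ((1 + PowerSeries.X) ^ i - 1)) j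

/-- The logarithmic derivative `u ∂/∂u` of the right-hand side. -/
noncomputable def logDerivU {R : Type*} [CommRing R] (X : ℕ → R) : PowerSeries (PowerSeries R) :=
  PowerSeries.mk fun i => PowerSeries.C (X i) * (1 - geom R ^ i)

/-- The logarithmic derivative `t ∂/∂t` of the right-hand side. -/
noncomputable def logDerivT {R : Type*} [CommRing R] (z : R) (X : ℕ → R) : PowerSeries (PowerSeries R) :=
  PowerSeries.mk fun k =>
    PowerSeries.C (if k = 0 then z else X k) * (PowerSeries.X * geom R ^ (k + 1))

theorem coeff_zero_logDerivU {R : Type*} [CommRing R] (X : ℕ → R) :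
    PowerSeries.coeff 0 (logDerivU X) = 0 := by
  simp [logDerivU]

theorem euler_mk_uCoeff (z : R) (X : ℕ → R) :
    euler _ (PowerSeries.mk (uCoeff z X)) = logDerivU X * PowerSeries.mk (uCoeff z X) := by
  ext1 j
  rw [coeff_euler, coeff_mul_of_coeff_zero (coeff_zero_logDerivU X), PowerSeries.coeff_mk, uCoeff,
    mul_left_comm, natCast_mul_cycleIndex, Finset.mul_sum]
  refine Finset.sum_congr rfl fun i hi => ?_
  have hi' : i + (j - i) = j := by
    rw [Finset.mem_Icc] at hi
    omega
  have hg : geom R ^ i * (1 + PowerSeries.X) ^ i = 1 := by rw [← mul_pow, geom_mul, one_pow]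
  rw [logDerivU, PowerSeries.coeff_mk, PowerSeries.coeff_mk, uCoeff]
  -- Splitting off `geom R ^ i` turns `(1+t)^i - 1` into `1 - (1+t)^(-i)`.
  nth_rw 1 [← hi']
  rw [pow_add]
  linear_combination (binomSeries z * geom R ^ (j - i) * PowerSeries.C (X i) *
    cycleIndex (fun i => PowerSeries.C (X i) * ((1 + PowerSeries.X) ^ i - 1)) (j - i)) * hg

/-- Equality of mixed derivatives of the logarithm; the term `z` sits at `u ^ 0` and is killed by `u
∂/∂u`. -/
theorem innerEuler_logDerivU {R : Type*} [CommRing R] (z : R) (X : ℕ → R) :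
    innerEuler (logDerivU X) = euler _ (logDerivT z X) := by
  ext1 k
  have h1 : euler R (1 : PowerSeries R) = 0 := by simp [euler]
  rw [innerEuler, PowerSeries.coeff_mk, coeff_euler, logDerivU, logDerivT, PowerSeries.coeff_mk,
    PowerSeries.coeff_mk, euler_C_mul, euler_sub, h1, euler_geom_pow]
  rcases Nat.eq_zero_or_pos k with rfl | hk
  · simp
  · rw [if_neg hk.ne']
    ring

/-- Only `u = 0` needs checking, where the series is `(1+t)^z`. -/
theorem innerEuler_mk_uCoeff (z : R) (X : ℕ → R) :
    innerEuler (PowerSeries.mk (uCoeff z X)) = logDerivT z X * PowerSeries.mk (uCoeff z X) := by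
  refine innerEuler_eq_mul (euler_mk_uCoeff z X) (coeff_zero_logDerivU X)
    (innerEuler_logDerivU z X) ?_
  rw [innerEuler, PowerSeries.coeff_mk, PowerSeries.coeff_mk, PowerSeries.coeff_mul,
    Finset.Nat.antidiagonal_zero, Finset.sum_singleton, PowerSeries.coeff_mk, logDerivT,
    PowerSeries.coeff_mk, if_pos rfl, uCoeff, cycleIndex_zero, pow_zero, mul_one, mul_one,
    euler_binomSeries, zero_add, pow_one]

/-- The rising factorials come from the negative binomial series: `(m+1)_k / k!` is the binomial
coefficient of `m + k` over `k`. -/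
theorem coeff_logDerivT (z : R) (X : ℕ → R) (k m : ℕ) :
    PowerSeries.coeff (m + 1) (PowerSeries.coeff k (logDerivT z X)) =
      PowerSeries.coeff k ((-1) ^ m * rowSeries z X (m + 1)) := by
  have hs : ((-1) ^ m : PowerSeries R) = PowerSeries.C ((-1) ^ m) := by simp
  rw [logDerivT, PowerSeries.coeff_mk, PowerSeries.coeff_C_mul, PowerSeries.coeff_succ_X_mul,
    coeff_geom_pow_succ, hs, PowerSeries.coeff_C_mul, rowSeries, map_add, PowerSeries.coeff_mk,
    PowerSeries.coeff_C]
  rcases Nat.eq_zero_or_pos k with rfl | hk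
  · simp [mul_comm]
  · have hf : (k.factorial : ℚ) ≠ 0 := by positivity
    rw [if_neg hk.ne', if_neg hk.ne', if_neg hk.ne', Nat.ascFactorial_eq_factorial_mul_choose,
      Nat.cast_mul, mul_div_cancel_left₀ _ hf, Algebra.smul_def, map_natCast, add_comm m k]
    ring

/-- At `t = 0` the factors `1 - (1+t)^(-i)` vanish, hence so does `u ∂/∂u` of the series. -/
theorem coeff_zero_uCoeff (z : R) (X : ℕ → R) {j : ℕ} (hj : 0 < j) :
    PowerSeries.coeff 0 (uCoeff z X j) = 0 := by
  have h := congrArg (PowerSeries.coeff j) (euler_mk_uCoeff z X)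
  rw [coeff_euler, coeff_mul_of_coeff_zero (coeff_zero_logDerivU X), PowerSeries.coeff_mk] at h
  replace h := congrArg (PowerSeries.constantCoeff (R := R)) h
  rw [map_mul, map_natCast, map_sum, Finset.sum_eq_zero] at h
  · exact (isUnit_natCast (S := R) hj).mul_left_cancel (by simpa using h)
  · intro i _
    simp [logDerivU, geom]

/-- The double series is transposed: its coefficients of `t ^ n`, as series in `u`, satisfy the
recursion read off from `innerEuler_mk_uCoeff`. -/
theorem partitionSum_eq_mk_coeff_uCoeff (z : R) (X : ℕ → R) (n : ℕ) :
    partitionSum z X n = PowerSeries.mk fun j => PowerSeries.coeff n (uCoeff z X j) := by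
  rw [partitionSum_eq_cycleIndex]
  symm
  refine eq_cycleIndex_of_rec _
    (fun n => PowerSeries.mk fun j => PowerSeries.coeff n (uCoeff z X j)) ?_ (fun n => ?_) n
  · ext j
    rw [PowerSeries.coeff_mk, PowerSeries.coeff_one]
    split_ifs with hj
    · subst hj
      simp [uCoeff, cycleIndex_zero, binomSeries, binom_zero]
    · exact coeff_zero_uCoeff z X (Nat.pos_of_ne_zero hj)
  · ext j
    have h := congrArg (fun F => PowerSeries.coeff n (PowerSeries.coeff j F))
      (innerEuler_mk_uCoeff z X)
    simp only [innerEuler, PowerSeries.coeff_mk, coeff_euler] at h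
    rw [← map_natCast PowerSeries.C, PowerSeries.coeff_C_mul, PowerSeries.coeff_mk, h,
      PowerSeries.coeff_mul, map_sum, map_sum]
    have h0 : ∀ k, PowerSeries.coeff 0 (PowerSeries.coeff k (logDerivT z X)) = 0 := by
      simp [logDerivT]
    simp only [coeff_mul_of_coeff_zero (h0 _), PowerSeries.coeff_mul, PowerSeries.coeff_mk]
    rw [Finset.sum_comm]
    refine Finset.sum_congr rfl fun i hi => Finset.sum_congr rfl fun p _ => ?_
    obtain ⟨m, rfl⟩ := Nat.exists_eq_add_of_le' (Finset.mem_Icc.1 hi).1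
    rw [coeff_logDerivT, Nat.add_sub_cancel, PowerSeries.coeff_mul p.1]

theorem coeff_uCoeff (z : R) (X : ℕ → R) (n j : ℕ) :
    PowerSeries.coeff n (uCoeff z X j) =
      ∑ k ∈ Finset.range (min n j + 1), binom (z - j) (n - k) * P X j k := by
  rw [uCoeff, ← binomSeries_sub_natCast, ← mk_P, mul_comm, PowerSeries.coeff_mul,
    Finset.Nat.sum_antidiagonal_eq_sum_range_succ_mk]
  simp only [binomSeries, PowerSeries.coeff_mk]
  symm
  refine (Finset.sum_subset (fun k hk => ?_) fun k hk hk' => ?_).trans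
    (Finset.sum_congr rfl fun k _ => mul_comm _ _)
  · rw [Finset.mem_range] at hk ⊢
    omega
  · rw [Finset.mem_range] at hk hk'
    -- The convolution runs over `k ≤ n`; the terms with `k > j` vanish because a diagram with `j`
    -- cells has no `k` points.
    rw [P_eq_zero X (by omega), mul_zero]

end Main

end PartitionIdentity

theorem mainTheorem2 (K : Type*) [CommRing K] [Algebra ℚ K] (n : ℕ) (hn : 1 ≤ n)
    (z : MvPolynomial PartitionIdentity.Indet K)
    (hz : z = MvPolynomial.X PartitionIdentity.Indet.z)
    (X : ℕ → MvPolynomial PartitionIdentity.Indet K)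
    (hX : ∀ k, X k = MvPolynomial.X (PartitionIdentity.Indet.X k)) :
    PartitionIdentity.partitionSum z X n =
      PowerSeries.mk fun j =>
        ∑ k ∈ Finset.range (min n j + 1),
          PartitionIdentity.binom (z - (j : MvPolynomial PartitionIdentity.Indet K)) (n - k) *
            PartitionIdentity.P X j k := by
  ext j
  rw [PartitionIdentity.partitionSum_eq_mk_coeff_uCoeff, PowerSeries.coeff_mk, PowerSeries.coeff_mk,
    PartitionIdentity.coeff_uCoeff]
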